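/- Let $f:(0,\infty)\to[0,\infty)$ be Lebesgue measurable with $\lambda_t f:=\int_0^t f(x)\,dx<\infty$ for every $t>0$. Let $\Gamma=(\Gamma_t)_{t\ge 0}$ be a standard Gamma process on a probability space: $\Gamma_0=0$ a.s., the paths are a.s. increasing and right-continuous, the increments are independent, and for $s<t$ the increment $\Gamma_t-\Gamma_s$ has the Gamma distribution with shape $t-s$ and rate $1$. Let $\Gamma_t f:=\int_{(0,t]} f\,d\Gamma$ be the pathwise Lebesgue–Stieltjes integral. We say that $f$ satisfies orderly divergence (OD) if $\lambda_t f\to\infty$ and $\Gamma_t f/\lambda_t f\to 1$ in probability as $t\to\infty$. Put $$v_t=\frac{\lambda_t (f^2)}{(\lambda_t f)^2},\qquad \ell_t=\frac{\lambda_{t-1}f}{\lambda_t f},\qquad b_t=\frac{f(t)}{\lambda_t f}.$$ All limits are taken as $t\to\infty$ through the real numbers. (0) If $f$ satisfies OD (with respect to some such $\Gamma$), then $\ell_t\to 1$. (1) If $\int_0^t f(x)^2\,dx<\infty$ for every $t>0$, $f(t)\to\infty$ and $b_t\to 0$, then $v_t\to 0$. (2) If $f$ is monotonic (increasing or decreasing,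 not necessarily strictly) on $(0,\infty)$ and is not almost everywhere equal to $0$, then $\ell_t\to 1$ if and only if $b_t\to 0$. -/

import Mathlib

open MeasureTheory ProbabilityTheory Filter Topology Set
open scoped NNReal

namespace GammaOD

/-- The standard Gamma process on `[0, ∞)` under `P` (so that `Γ 1` is exponential with mean `1`):
it starts at `0`, its paths are almost surely increasing and right-continuous, its increments are
independent, and `Γ t - Γ s` has the Gamma law with shape `t - s` and rate `1` for `s < t`. -/
structure IsGammaProcess {Ω : Type*} [MeasurableSpace Ω] (Γ : ℝ≥0 → Ω → ℝ) (P : Measure Ω) :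
    Prop where
  measurable : ∀ t, Measurable (Γ t)
  start_zero : ∀ᵐ ω ∂P, Γ 0 ω = 0
  paths : ∀ᵐ ω ∂P, Monotone (fun t => Γ t ω) ∧
    ∀ t, ContinuousWithinAt (fun t => Γ t ω) (Ici t) t
  indep_increments : HasIndepIncrements Γ P
  increment_law : ∀ s t : ℝ≥0, s < t →
    HasLaw (fun ω => Γ t ω - Γ s ω) (gammaMeasure ((t : ℝ) - (s : ℝ)) 1) P

/-- An increasing right-continuous path on `[0, ∞)`, extended by its value at `0` to the negative
half-line, as a Stieltjes function. -/
noncomputable def pathStieltjes (γ : ℝ≥0 → ℝ) (hm : Monotone γ)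
    (hc : ∀ t, ContinuousWithinAt γ (Ici t) t) : StieltjesFunction ℝ where
  toFun x := γ x.toNNReal
  mono' _ _ h := hm (Real.toNNReal_mono h)
  right_continuous' x := (hc x.toNNReal).comp continuous_real_toNNReal.continuousWithinAt
    (fun _ hy => Real.toNNReal_mono hy)

open scoped Classical in
/-- The Lebesgue–Stieltjes measure `dγ` of a path `γ`; it gives mass `γ b - γ a` to `(a, b]` for
`0 ≤ a ≤ b`. (It is set to `0` for the paths that are not increasing and right-continuous; for a
Gamma process they form a null set.) -/
noncomputable def pathMeasure (γ : ℝ≥0 → ℝ) : Measure ℝ :=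
  if h : Monotone γ ∧ ∀ t, ContinuousWithinAt γ (Ici t) t then
    (pathStieltjes γ h.1 h.2).measure
  else 0

/-- The pathwise integral `Γ_t f = ∫_{(0,t]} f dΓ`. -/
noncomputable def gammaIntegral {Ω : Type*} (Γ : ℝ≥0 → Ω → ℝ) (f : ℝ → ℝ) (t : ℝ) (ω : Ω) : ℝ :=
  ∫ x in Ioc 0 t, f x ∂(pathMeasure fun s => Γ s ω)

/-- `λ_t f = ∫_0^t f(x) dx`. -/
noncomputable def lam (f : ℝ → ℝ) (t : ℝ) : ℝ := ∫ x in Ioc 0 t, f x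

/-- `v_t = λ_t(f²) / (λ_t f)²`. -/
noncomputable def vRatio (f : ℝ → ℝ) (t : ℝ) : ℝ := lam (fun x => f x ^ 2) t / lam f t ^ 2

/-- `ℓ_t = λ_{t-1} f / λ_t f`. -/
noncomputable def lRatio (f : ℝ → ℝ) (t : ℝ) : ℝ := lam f (t - 1) / lam f t

/-- `b_t = f(t) / λ_t f`. -/
noncomputable def bRatio (f : ℝ → ℝ) (t : ℝ) : ℝ := f t / lam f t

/-- Orderly divergence: `λ_t f → ∞` and `Γ_t f / λ_t f → 1` in probability as `t → ∞`. -/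
def OrderlyDivergent {Ω : Type*} [MeasurableSpace Ω] (Γ : ℝ≥0 → Ω → ℝ) (P : Measure Ω)
    (f : ℝ → ℝ) : Prop :=
  Tendsto (lam f) atTop atTop ∧
    TendstoInMeasure P (fun (t : ℝ) ω => gammaIntegral Γ f t ω / lam f t) atTop (fun _ => (1 : ℝ))

end GammaOD

/-!
Part (0) rests on an Esscher transform. Under the probability measure proportional to
`exp (-θ (Γ b - Γ a)) P` the increments of `Γ` inside `[a, b]` are Gamma distributed with rate
`1 + θ`, so the random measure `dΓ` on `(a, b]` has mean `(1 + θ)⁻¹` times Lebesgue measure, while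
the density with respect to `P` is at most `(1 + θ) ^ (b - a)`. With `θ = 1`, Markov's inequality
under the new measure shows that, whatever `f ≥ 0` is, the integral of `f` against `dΓ` over
`(t - 1, t]` stays below `3/4` of its mean with `P`-probability at least `1/6`. Were
`ℓ_t ≤ 1 - ε`, this increment would be a fixed fraction of `λ_t f`, and the closeness of
`Γ_{t-1} f` and `Γ_t f` to their means with high probability would push it above `3/4` of its mean.

For part (1), `f(x) ≤ δ λ_x f` for `x ≥ T` gives `λ_t (f²) ≤ λ_T (f²) + δ (λ_t f)²`. For part (2),
an increasing `f` satisfies `1 - ℓ_t ≤ b_t ≤ 1 / ℓ_{t+1} - 1`, while a function decreasing on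
`(T, ∞)` with `T ≥ 0` satisfies `b_t ≤ 1 / (t - T)` and `1 - ℓ_t ≤ b_{t-1}`, so that both limits
hold.
-/

namespace GammaOD

section Deterministic

variable {f : ℝ → ℝ} {s t T c δ : ℝ}

lemma lam_nonneg (hf0 : ∀ x, 0 < x → 0 ≤ f x) (t : ℝ) : 0 ≤ lam f t :=
  setIntegral_nonneg measurableSet_Ioc fun x hx => hf0 x hx.1

lemma lam_le_lam (hf0 : ∀ x, 0 < x → 0 ≤ f x) (hf : IntegrableOn f (Ioc 0 t)) (hst : s ≤ t) :
    lam f s ≤ lam f t :=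
  setIntegral_mono_set hf ((ae_restrict_mem measurableSet_Ioc).mono fun x hx => hf0 x hx.1)
    (Ioc_subset_Ioc_right hst).eventuallyLE

lemma lam_sub_lam (hf : IntegrableOn f (Ioc 0 t)) (hs : 0 ≤ s) (hst : s ≤ t) :
    lam f t - lam f s = ∫ x in Ioc s t, f x := by
  have hsplit := setIntegral_union (Ioc_disjoint_Ioc_of_le le_rfl) measurableSet_Ioc
    (hf.mono_set (Ioc_subset_Ioc_right hst)) (hf.mono_set (Ioc_subset_Ioc_left hs))
  rw [Ioc_union_Ioc_eq_Ioc hs hst] at hsplit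
  exact sub_eq_of_eq_add' hsplit

lemma lam_sub_lam_le (hf : IntegrableOn f (Ioc 0 t)) (hs : 0 ≤ s) (hst : s ≤ t)
    (h : ∀ x ∈ Ioc s t, f x ≤ c) : lam f t - lam f s ≤ c * (t - s) := by
  calc lam f t - lam f s = ∫ x in Ioc s t, f x := lam_sub_lam hf hs hst
    _ ≤ ∫ _ in Ioc s t, c := setIntegral_mono_on (hf.mono_set (Ioc_subset_Ioc_left hs))
        (integrableOn_const measure_Ioc_lt_top.ne) measurableSet_Ioc h
    _ = c * (t - s) := by
        rw [setIntegral_const, Real.volume_real_Ioc_of_le hst, smul_eq_mul, mul_comm]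

lemma le_lam_sub_lam (hf : IntegrableOn f (Ioc 0 t)) (hs : 0 ≤ s) (hst : s ≤ t)
    (h : ∀ x ∈ Ioc s t, c ≤ f x) : c * (t - s) ≤ lam f t - lam f s := by
  calc c * (t - s) = ∫ _ in Ioc s t, c := by
        rw [setIntegral_const, Real.volume_real_Ioc_of_le hst, smul_eq_mul, mul_comm]
    _ ≤ ∫ x in Ioc s t, f x := setIntegral_mono_on (integrableOn_const measure_Ioc_lt_top.ne)
        (hf.mono_set (Ioc_subset_Ioc_left hs)) measurableSet_Ioc h
    _ = lam f t - lam f s := (lam_sub_lam hf hs hst).symm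

lemma tendsto_lam_atTop (hf0 : ∀ x, 0 < x → 0 ≤ f x)
    (hf : ∀ t, 0 < t → IntegrableOn f (Ioc 0 t)) (h : Tendsto f atTop atTop) :
    Tendsto (lam f) atTop atTop := by
  obtain ⟨T, hT⟩ := eventually_atTop.1 ((h.eventually_ge_atTop 1).and (eventually_ge_atTop 0))
  refine tendsto_atTop_mono' atTop ?_ (tendsto_atTop_add_const_right atTop (-T) tendsto_id)
  filter_upwards [eventually_ge_atTop T, eventually_gt_atTop 0] with t hTt ht
  have hincr := le_lam_sub_lam (hf t ht) (hT T le_rfl).2 hTt fun x hx => (hT x hx.1.le).1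
  have hpos := lam_nonneg hf0 T
  rw [id]
  linarith

lemma lam_sq_le (hf0 : ∀ x, 0 < x → 0 ≤ f x) (hf : IntegrableOn f (Ioc 0 t))
    (hf2 : IntegrableOn (fun x => f x ^ 2) (Ioc 0 t)) (hT : 0 ≤ T) (hTt : T ≤ t) (hδ : 0 ≤ δ)
    (h : ∀ x ∈ Ioc T t, f x ≤ δ * lam f x) :
    lam (fun x => f x ^ 2) t ≤ lam (fun x => f x ^ 2) T + δ * lam f t ^ 2 := by
  have hfT : IntegrableOn f (Ioc T t) := hf.mono_set (Ioc_subset_Ioc_left hT)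
  have hf2T : IntegrableOn (fun x => f x ^ 2) (Ioc T t) := hf2.mono_set (Ioc_subset_Ioc_left hT)
  have hpointwise : ∀ x ∈ Ioc T t, f x ^ 2 ≤ δ * lam f t * f x := fun x hx => by
    have hlam : lam f x ≤ lam f t := lam_le_lam hf0 hf hx.2
    rw [sq]
    exact mul_le_mul_of_nonneg_right ((h x hx).trans (by gcongr)) (hf0 x (hT.trans_lt hx.1))
  rw [← sub_le_iff_le_add']
  calc lam (fun x => f x ^ 2) t - lam (fun x => f x ^ 2) T
      = ∫ x in Ioc T t, f x ^ 2 := lam_sub_lam hf2 hT hTt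
    _ ≤ ∫ x in Ioc T t, δ * lam f t * f x :=
        setIntegral_mono_on hf2T (hfT.const_mul _) measurableSet_Ioc hpointwise
    _ = δ * lam f t * (lam f t - lam f T) := by rw [integral_const_mul, lam_sub_lam hf hT hTt]
    _ ≤ δ * lam f t * lam f t := by
        have := lam_nonneg hf0 t
        gcongr
        exact sub_le_self _ (lam_nonneg hf0 T)
    _ = δ * lam f t ^ 2 := by ring

lemma tendsto_vRatio (hf0 : ∀ x, 0 < x → 0 ≤ f x) (hf : ∀ t, 0 < t → IntegrableOn f (Ioc 0 t))
    (hf2 : ∀ t, 0 < t → IntegrableOn (fun x => f x ^ 2) (Ioc 0 t))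
    (hlam : Tendsto (lam f) atTop atTop) (hb : Tendsto (bRatio f) atTop (𝓝 0)) :
    Tendsto (vRatio f) atTop (𝓝 0) := by
  refine tendsto_order.2 ⟨fun c hc => Eventually.of_forall fun t => hc.trans_le
    (div_nonneg (lam_nonneg (fun x _ => sq_nonneg (f x)) t) (sq_nonneg _)), fun ε hε => ?_⟩
  obtain ⟨T, hT⟩ := eventually_atTop.1 ((hb.eventually_lt_const (half_pos hε)).and
    ((hlam.eventually_gt_atTop 0).and (eventually_ge_atTop 0)))
  have hinit : Tendsto (fun t => lam (fun x => f x ^ 2) T / lam f t ^ 2) atTop (𝓝 0) :=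
    ((tendsto_pow_atTop two_ne_zero).comp hlam).const_div_atTop _
  filter_upwards [hinit.eventually_lt_const (half_pos hε), eventually_ge_atTop T,
    eventually_gt_atTop 0] with t hinit hTt ht
  have hpos : 0 < lam f t := (hT t hTt).2.1
  have hsq := lam_sq_le hf0 (hf t ht) (hf2 t ht) (hT T le_rfl).2.2 hTt (half_pos hε).le
    fun x hx => ((div_lt_iff₀ (hT x hx.1.le).2.1).1 (hT x hx.1.le).1).le
  calc vRatio f t ≤ (lam (fun x => f x ^ 2) T + ε / 2 * lam f t ^ 2) / lam f t ^ 2 := by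
        rw [vRatio]
        gcongr
    _ = lam (fun x => f x ^ 2) T / lam f t ^ 2 + ε / 2 := by field_simp
    _ < ε := by linarith

lemma bRatio_nonneg (hf0 : ∀ x, 0 < x → 0 ≤ f x) (ht : 0 < t) : 0 ≤ bRatio f t :=
  div_nonneg (hf0 t ht) (lam_nonneg hf0 t)

lemma lRatio_le_one (hf0 : ∀ x, 0 < x → 0 ≤ f x) (hf : IntegrableOn f (Ioc 0 t)) :
    lRatio f t ≤ 1 :=
  div_le_one_of_le₀ (lam_le_lam hf0 hf (sub_le_self _ zero_le_one)) (lam_nonneg hf0 t)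

lemma one_sub_lRatio_le (hf : IntegrableOn f (Ioc 0 t)) (ht : 1 ≤ t) (hl : 0 < lam f t)
    (h : ∀ x ∈ Ioc (t - 1) t, f x ≤ c) : 1 - lRatio f t ≤ c / lam f t := by
  have hincr := lam_sub_lam_le hf (sub_nonneg.2 ht) (sub_le_self t zero_le_one) h
  rw [sub_sub_cancel, mul_one] at hincr
  rw [lRatio, one_sub_div hl.ne']
  gcongr

lemma eventually_lam_pos (hf0 : ∀ x, 0 < x → 0 ≤ f x)
    (hf : ∀ t, 0 < t → IntegrableOn f (Ioc 0 t)) (hpos : ∃ t, 0 < lam f t) :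
    ∀ᶠ t in atTop, 0 < lam f t := by
  obtain ⟨s, hs⟩ := hpos
  filter_upwards [eventually_ge_atTop s, eventually_gt_atTop 0] with t hst ht
  exact hs.trans_le (lam_le_lam hf0 (hf t ht) hst)

lemma tendsto_lRatio_of_one_sub_le (hf0 : ∀ x, 0 < x → 0 ≤ f x)
    (hf : ∀ t, 0 < t → IntegrableOn f (Ioc 0 t)) {u : ℝ → ℝ} (hu : Tendsto u atTop (𝓝 0))
    (h : ∀ᶠ t in atTop, 1 - lRatio f t ≤ u t) : Tendsto (lRatio f) atTop (𝓝 1) := by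
  refine tendsto_of_tendsto_of_tendsto_of_le_of_le' (by simpa using hu.const_sub 1)
    tendsto_const_nhds (h.mono fun t ht => sub_le_comm.1 ht) ?_
  filter_upwards [eventually_gt_atTop 0] with t ht using lRatio_le_one hf0 (hf t ht)

lemma tendsto_lRatio_of_monotoneOn (hf0 : ∀ x, 0 < x → 0 ≤ f x)
    (hf : ∀ t, 0 < t → IntegrableOn f (Ioc 0 t)) (hmono : MonotoneOn f (Ioi T))
    (hpos : ∃ t, 0 < lam f t) (hb : Tendsto (bRatio f) atTop (𝓝 0)) :
    Tendsto (lRatio f) atTop (𝓝 1) := by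
  refine tendsto_lRatio_of_one_sub_le hf0 hf hb ?_
  filter_upwards [eventually_ge_atTop 1, eventually_ge_atTop (T + 1),
    eventually_lam_pos hf0 hf hpos] with t ht hTt hl
  have hT : T ≤ t - 1 := le_sub_iff_add_le.2 hTt
  exact one_sub_lRatio_le (hf t (by positivity)) ht hl fun x hx =>
    hmono (hT.trans_lt hx.1) (hT.trans_lt (hx.1.trans_le hx.2)) hx.2

lemma tendsto_bRatio_of_monotoneOn (hf0 : ∀ x, 0 < x → 0 ≤ f x)
    (hf : ∀ t, 0 < t → IntegrableOn f (Ioc 0 t)) (hmono : MonotoneOn f (Ioi T))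
    (hpos : ∃ t, 0 < lam f t) (hl : Tendsto (lRatio f) atTop (𝓝 1)) :
    Tendsto (bRatio f) atTop (𝓝 0) := by
  have hlim : Tendsto (fun t => (lRatio f (t + 1))⁻¹ - 1) atTop (𝓝 0) := by
    simpa using ((hl.comp (tendsto_atTop_add_const_right atTop 1 tendsto_id)).inv₀
      one_ne_zero).sub_const 1
  refine squeeze_zero' ?_ ?_ hlim
  · filter_upwards [eventually_gt_atTop 0] with t ht using bRatio_nonneg hf0 ht
  · filter_upwards [eventually_gt_atTop 0, eventually_gt_atTop T,
      eventually_lam_pos hf0 hf hpos] with t ht hTt hlt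
    have hincr := le_lam_sub_lam (c := f t) (hf (t + 1) (by positivity)) ht.le
      (le_add_of_nonneg_right zero_le_one) fun x hx => hmono hTt (hTt.trans hx.1) hx.1.le
    rw [add_sub_cancel_left, mul_one] at hincr
    rw [lRatio, inv_div, add_sub_cancel_right, bRatio, div_sub_one hlt.ne']
    gcongr

lemma tendsto_bRatio_of_antitoneOn (hf0 : ∀ x, 0 < x → 0 ≤ f x)
    (hf : ∀ t, 0 < t → IntegrableOn f (Ioc 0 t)) (hanti : AntitoneOn f (Ioi T))
    (hpos : ∃ t, 0 < lam f t) : Tendsto (bRatio f) atTop (𝓝 0) := by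
  have hlim : Tendsto (fun t => (t - max T 0)⁻¹) atTop (𝓝 0) :=
    tendsto_inv_atTop_zero.comp (tendsto_atTop_add_const_right atTop (-max T 0) tendsto_id)
  refine squeeze_zero' ?_ ?_ hlim
  · filter_upwards [eventually_gt_atTop 0] with t ht using bRatio_nonneg hf0 ht
  · filter_upwards [eventually_gt_atTop (max T 0), eventually_lam_pos hf0 hf hpos] with t ht hl
    obtain ⟨hTt, h0t⟩ := max_lt_iff.1 ht
    have hincr := le_lam_sub_lam (c := f t) (hf t h0t) (le_max_right T 0) ht.le fun x hx =>
      hanti ((le_max_left T 0).trans_lt hx.1) hTt hx.2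
    rw [bRatio, div_le_iff₀ hl, le_inv_mul_iff₀ (sub_pos.2 ht), mul_comm]
    exact hincr.trans (sub_le_self _ (lam_nonneg hf0 _))

lemma tendsto_lRatio_of_antitoneOn (hf0 : ∀ x, 0 < x → 0 ≤ f x)
    (hf : ∀ t, 0 < t → IntegrableOn f (Ioc 0 t)) (hanti : AntitoneOn f (Ioi T))
    (hpos : ∃ t, 0 < lam f t) : Tendsto (lRatio f) atTop (𝓝 1) := by
  have hshift : Tendsto (fun t : ℝ => t - 1) atTop atTop :=
    tendsto_atTop_add_const_right atTop (-1) tendsto_id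
  refine tendsto_lRatio_of_one_sub_le hf0 hf
    ((tendsto_bRatio_of_antitoneOn hf0 hf hanti hpos).comp hshift) ?_
  filter_upwards [eventually_gt_atTop 1, hshift.eventually_gt_atTop T,
    hshift.eventually (eventually_lam_pos hf0 hf hpos)] with t ht hTt hl
  have hft : IntegrableOn f (Ioc 0 t) := hf t (by positivity)
  have hlt : lam f (t - 1) ≤ lam f t := lam_le_lam hf0 hft (sub_le_self t zero_le_one)
  have hf_nonneg : 0 ≤ f (t - 1) := hf0 _ (sub_pos.2 ht)
  calc 1 - lRatio f t ≤ f (t - 1) / lam f t := one_sub_lRatio_le hft ht.le (hl.trans_le hlt)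
        fun x hx => hanti hTt (hTt.trans hx.1) hx.1.le
    _ ≤ f (t - 1) / lam f (t - 1) := by gcongr

end Deterministic

section Tilting

variable {Ω E : Type*} [MeasurableSpace Ω] [MeasurableSpace E] {P : Measure Ω}

lemma measureReal_tilted_le_of_nonpos [IsFiniteMeasure P] {f : Ω → ℝ} (hf : ∀ᵐ ω ∂P, f ω ≤ 0)
    (A : Set Ω) : (P.tilted f).real A ≤ (∫ ω, Real.exp (f ω) ∂P)⁻¹ * P.real A := by
  have hZ : 0 ≤ (∫ ω, Real.exp (f ω) ∂P)⁻¹ := by positivity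
  have hle : P.tilted f ≤ ENNReal.ofReal (∫ ω, Real.exp (f ω) ∂P)⁻¹ • P := by
    rw [← withDensity_const]
    refine withDensity_mono (hf.mono fun ω hω => ENNReal.ofReal_le_ofReal ?_)
    rw [div_eq_mul_inv]
    exact mul_le_of_le_one_left hZ (Real.exp_le_one_iff.2 hω)
  have hA := ENNReal.toReal_mono (by rw [Measure.smul_apply, smul_eq_mul]; finiteness) (hle A)
  rwa [Measure.smul_apply, smul_eq_mul, ENNReal.toReal_mul, ENNReal.toReal_ofReal hZ] at hA

lemma map_tilted_comp {X : Ω → E} (hX : Measurable X) {f : E → ℝ} (hf : Measurable f) :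
    (P.tilted fun ω => f (X ω)).map X = (P.map X).tilted f := by
  ext s hs
  rw [Measure.map_apply hX hs, tilted_apply' _ _ (hX hs), tilted_apply' _ _ hs,
    setLIntegral_map hs (by fun_prop) hX,
    integral_map hX.aemeasurable hf.exp.aestronglyMeasurable]

lemma integrable_exp_of_ae_nonpos [IsFiniteMeasure P] {f : Ω → ℝ} (hf : AEMeasurable f P)
    (hf0 : ∀ᵐ ω ∂P, f ω ≤ 0) : Integrable (fun ω => Real.exp (f ω)) P := by
  refine .of_bound hf.exp.aestronglyMeasurable 1 (hf0.mono fun ω hω => ?_)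
  rw [Real.norm_eq_abs, Real.abs_exp]
  exact Real.exp_le_one_iff.2 hω

lemma map_tilted_of_indepFun [IsProbabilityMeasure P] {X : Ω → E} {W : Ω → ℝ} (hX : Measurable X)
    (hW : Measurable W) (hXW : X ⟂ᵢ[P] W) (hint : Integrable (fun ω => Real.exp (W ω)) P) :
    (P.tilted W).map X = P.map X := by
  have := isProbabilityMeasure_tilted hint
  ext s hs
  let w : ℝ → ENNReal := fun y => ENNReal.ofReal (Real.exp y / ∫ ω, Real.exp (W ω) ∂P)
  have hw : Measurable w := by fun_prop
  calc (P.tilted W).map X s = ∫⁻ ω, s.indicator 1 (X ω) * w (W ω) ∂P := by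
        rw [Measure.map_apply hX hs, tilted_apply' _ _ (hX hs), ← lintegral_indicator (hX hs)]
        refine lintegral_congr fun ω => ?_
        by_cases hω : X ω ∈ s <;> simp [hω, w]
    _ = (∫⁻ ω, s.indicator 1 (X ω) ∂P) * ∫⁻ ω, w (W ω) ∂P :=
        lintegral_mul_eq_lintegral_mul_lintegral_of_indepFun
          ((measurable_one.indicator hs).comp hX) (hw.comp hW)
          (hXW.comp (measurable_one.indicator hs) hw)
    _ = P.map X s * P.tilted W univ := by
        rw [tilted_apply' _ _ .univ, setLIntegral_univ,
          ← lintegral_map (f := s.indicator 1) (measurable_one.indicator hs) hX,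
          lintegral_indicator_one hs]
    _ = P.map X s := by rw [measure_univ, mul_one]

lemma integral_exp_and_tilted_eq_of_withDensity_exp {μ ν : Measure E} [IsProbabilityMeasure ν]
    {f : E → ℝ} (hf : Measurable f) {c : ℝ} (hc : 0 < c)
    (h : μ.withDensity (fun x => ENNReal.ofReal (Real.exp (f x))) = ENNReal.ofReal c • ν) :
    ∫ x, Real.exp (f x) ∂μ = c ∧ μ.tilted f = ν := by
  have hint : ∫ x, Real.exp (f x) ∂μ = c := by
    rw [integral_eq_lintegral_of_nonneg_ae (ae_of_all _ fun _ => (Real.exp_pos _).le)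
      hf.exp.aestronglyMeasurable, ← setLIntegral_univ, ← withDensity_apply _ .univ, h]
    simp [hc.le]
  refine ⟨hint, ?_⟩
  have hdens : (fun x => ENNReal.ofReal (Real.exp (f x) / c)) =
      (ENNReal.ofReal c)⁻¹ • fun x => ENNReal.ofReal (Real.exp (f x)) := by
    ext x
    rw [ENNReal.ofReal_div_of_pos hc, ENNReal.div_eq_inv_mul, Pi.smul_apply, smul_eq_mul]
  rw [Measure.tilted, hint, hdens, withDensity_smul _ (by fun_prop), h, smul_smul,
    ENNReal.inv_mul_cancel (by simpa using hc) ENNReal.ofReal_ne_top, one_smul]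

end Tilting

section GammaLaw

variable {a r θ : ℝ}

lemma gammaPDFReal_mul_exp_neg (ha : 0 < a) (hr : 0 < r) (hrθ : 0 < r + θ) (x : ℝ) :
    gammaPDFReal a r x * Real.exp (-θ * x) =
      (r / (r + θ)) ^ a * gammaPDFReal a (r + θ) x := by
  rcases lt_or_ge x 0 with hx | hx
  · simp [gammaPDFReal, hx.not_ge]
  · have hexp : Real.exp (-((r + θ) * x)) = Real.exp (-(r * x)) * Real.exp (-θ * x) := by
      rw [← Real.exp_add]
      ring_nf
    have := Real.Gamma_pos_of_pos ha
    have := Real.rpow_pos_of_pos hrθ a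
    rw [gammaPDFReal, gammaPDFReal, if_pos hx, if_pos hx, hexp, Real.div_rpow hr.le hrθ.le]
    field_simp

lemma mul_gammaPDFReal (ha : 0 < a) (hr : 0 < r) (x : ℝ) :
    x * gammaPDFReal a r x = a / r * gammaPDFReal (a + 1) r x := by
  rcases lt_trichotomy x 0 with hx | rfl | hx
  · simp [gammaPDFReal, hx.not_ge]
  · simp [gammaPDFReal, Real.zero_rpow ha.ne']
  · have := Real.Gamma_pos_of_pos ha
    rw [gammaPDFReal, gammaPDFReal, if_pos hx.le, if_pos hx.le, Real.Gamma_add_one ha.ne',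
      Real.rpow_add_one hr.ne', add_sub_cancel_right, Real.rpow_sub_one hx.ne']
    field_simp

lemma lintegral_ofReal_gammaMeasure (ha : 0 < a) (hr : 0 < r) :
    ∫⁻ x, ENNReal.ofReal x ∂gammaMeasure a r = ENNReal.ofReal (a / r) := by
  have hpdf (b : ℝ) : Measurable (gammaPDF b r) := (measurable_gammaPDFReal b r).ennreal_ofReal
  calc ∫⁻ x, ENNReal.ofReal x ∂gammaMeasure a r
      = ∫⁻ x, ENNReal.ofReal (a / r) * gammaPDF (a + 1) r x := by
        rw [gammaMeasure, lintegral_withDensity_eq_lintegral_mul _ (hpdf a) (by fun_prop)]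
        refine lintegral_congr fun x => ?_
        rw [Pi.mul_apply, gammaPDF, gammaPDF, ← ENNReal.ofReal_mul (gammaPDFReal_nonneg ha hr x),
          ← ENNReal.ofReal_mul (by positivity), mul_comm, mul_gammaPDFReal ha hr]
    _ = ENNReal.ofReal (a / r) := by
        rw [lintegral_const_mul _ (hpdf _), lintegral_gammaPDF_eq_one (by positivity) hr, mul_one]

lemma gammaMeasure_withDensity_exp (ha : 0 < a) (hr : 0 < r) (hrθ : 0 < r + θ) :
    (gammaMeasure a r).withDensity (fun x => ENNReal.ofReal (Real.exp (-θ * x))) =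
      ENNReal.ofReal ((r / (r + θ)) ^ a) • gammaMeasure a (r + θ) := by
  have hpdf (s : ℝ) : Measurable (gammaPDF a s) := (measurable_gammaPDFReal a s).ennreal_ofReal
  rw [gammaMeasure, gammaMeasure, ← withDensity_mul _ (hpdf r) (by fun_prop),
    ← withDensity_smul _ (hpdf _)]
  congr 1 with x
  simp only [Pi.mul_apply, Pi.smul_apply, smul_eq_mul, gammaPDF]
  rw [← ENNReal.ofReal_mul (gammaPDFReal_nonneg ha hr x), ← ENNReal.ofReal_mul (by positivity),
    gammaPDFReal_mul_exp_neg ha hr hrθ]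

lemma integral_exp_neg_gammaMeasure (ha : 0 < a) (hr : 0 < r) (hrθ : 0 < r + θ) :
    ∫ x, Real.exp (-θ * x) ∂gammaMeasure a r = (r / (r + θ)) ^ a :=
  have := isProbabilityMeasure_gammaMeasure ha hrθ
  (integral_exp_and_tilted_eq_of_withDensity_exp (by fun_prop) (by positivity)
    (gammaMeasure_withDensity_exp ha hr hrθ)).1

lemma tilted_gammaMeasure (ha : 0 < a) (hr : 0 < r) (hrθ : 0 < r + θ) :
    (gammaMeasure a r).tilted (fun x => -θ * x) = gammaMeasure a (r + θ) :=
  have := isProbabilityMeasure_gammaMeasure ha hrθ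
  (integral_exp_and_tilted_eq_of_withDensity_exp (by fun_prop) (by positivity)
    (gammaMeasure_withDensity_exp ha hr hrθ)).2

end GammaLaw

section Esscher

variable {Ω : Type*} [MeasurableSpace Ω] {P : Measure Ω} {Γ : ℝ≥0 → Ω → ℝ} {θ : ℝ}
  {a b u v : ℝ≥0}

/-- The Esscher transform of `P`: the probability measure proportional to `exp (-θ (Γ b - Γ a)) P`,
under which the increments of a Gamma process on `[a, b]` have rate `1 + θ` instead of `1`. -/
noncomputable def esscher (Γ : ℝ≥0 → Ω → ℝ) (P : Measure Ω) (θ : ℝ) (a b : ℝ≥0) : Measure Ω :=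
  P.tilted fun ω => -θ * (Γ b ω - Γ a ω)

lemma esscher_zero [IsProbabilityMeasure P] : esscher Γ P 0 a b = P := by
  simp [esscher]

lemma esscher_absolutelyContinuous : esscher Γ P θ a b ≪ P :=
  tilted_absolutelyContinuous _ _

namespace IsGammaProcess

lemma ae_neg_mul_sub_nonpos (hΓ : IsGammaProcess Γ P) (hθ : 0 ≤ θ) (huv : u ≤ v) :
    ∀ᵐ ω ∂P, -θ * (Γ v ω - Γ u ω) ≤ 0 := by
  filter_upwards [hΓ.paths] with ω hω
  exact mul_nonpos_of_nonpos_of_nonneg (neg_nonpos.2 hθ) (sub_nonneg.2 (hω.1 huv))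

lemma measurable_neg_mul_sub (hΓ : IsGammaProcess Γ P) (θ : ℝ) (u v : ℝ≥0) :
    Measurable fun ω => -θ * (Γ v ω - Γ u ω) :=
  ((hΓ.measurable v).sub (hΓ.measurable u)).const_mul _

lemma integral_exp_neg_mul_sub (hΓ : IsGammaProcess Γ P) (hθ : 0 ≤ θ) (huv : u < v) :
    ∫ ω, Real.exp (-θ * (Γ v ω - Γ u ω)) ∂P = ((1 + θ) ^ ((v : ℝ) - u))⁻¹ := by
  have hlaw := (hΓ.increment_law u v huv).integral_comp (f := fun x => Real.exp (-θ * x))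
    (by fun_prop)
  have huv' : (0 : ℝ) < v - u := sub_pos.2 huv
  rw [← Real.inv_rpow (by positivity), ← one_div,
    ← integral_exp_neg_gammaMeasure huv' one_pos (by positivity)]
  exact hlaw

lemma indepFun_sub_outer_increments (hΓ : IsGammaProcess Γ P) (hau : a ≤ u) (huv : u ≤ v)
    (hvb : v ≤ b) :
    (fun ω => Γ v ω - Γ u ω) ⟂ᵢ[P] (fun ω => (Γ u ω - Γ a ω) + (Γ b ω - Γ v ω)) := by
  let τ : ℕ → ℝ≥0
    | 0 => a
    | 1 => u
    | 2 => v
    | _ => b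
  have hτ : Monotone τ := monotone_nat_of_le_succ fun n =>
    match n with
    | 0 => hau
    | 1 => huv
    | 2 => hvb
    | _ + 3 => le_rfl
  exact (hΓ.indep_increments.nat hτ).indepFun_add_right
    (fun i => (hΓ.measurable _).sub (hΓ.measurable _)) 1 0 2 (by decide) (by decide)

variable [IsProbabilityMeasure P]

lemma isProbabilityMeasure_esscher (hΓ : IsGammaProcess Γ P) (hθ : 0 ≤ θ) (hab : a ≤ b) :
    IsProbabilityMeasure (esscher Γ P θ a b) :=
  isProbabilityMeasure_tilted (integrable_exp_of_ae_nonpos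
    (hΓ.measurable_neg_mul_sub θ a b).aemeasurable (hΓ.ae_neg_mul_sub_nonpos hθ hab))

lemma measureReal_esscher_le (hΓ : IsGammaProcess Γ P) (hθ : 0 ≤ θ) (hab : a < b) (A : Set Ω) :
    (esscher Γ P θ a b).real A ≤ (1 + θ) ^ ((b : ℝ) - a) * P.real A := by
  have h := measureReal_tilted_le_of_nonpos (hΓ.ae_neg_mul_sub_nonpos hθ hab.le) A
  rwa [hΓ.integral_exp_neg_mul_sub hθ hab, inv_inv] at h

lemma hasLaw_sub_esscher (hΓ : IsGammaProcess Γ P) (hθ : 0 ≤ θ) (hau : a ≤ u) (huv : u < v)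
    (hvb : v ≤ b) :
    HasLaw (fun ω => Γ v ω - Γ u ω) (gammaMeasure ((v : ℝ) - u) (1 + θ)) (esscher Γ P θ a b) := by
  let X : Ω → ℝ := fun ω => Γ v ω - Γ u ω
  let W : Ω → ℝ := fun ω => -θ * ((Γ u ω - Γ a ω) + (Γ b ω - Γ v ω))
  have hX : Measurable X := (hΓ.measurable v).sub (hΓ.measurable u)
  have hW : Measurable W := (((hΓ.measurable u).sub (hΓ.measurable a)).add
    ((hΓ.measurable b).sub (hΓ.measurable v))).const_mul _
  have hXW : X ⟂ᵢ[P] W := (hΓ.indepFun_sub_outer_increments hau huv.le hvb).comp measurable_id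
    (measurable_const_mul (-θ))
  have hWint : Integrable (fun ω => Real.exp (W ω)) P := by
    refine integrable_exp_of_ae_nonpos hW.aemeasurable ?_
    filter_upwards [hΓ.ae_neg_mul_sub_nonpos hθ hau, hΓ.ae_neg_mul_sub_nonpos hθ hvb]
      with ω hau hvb
    exact (mul_add _ _ _).trans_le (add_nonpos hau hvb)
  have hsplit : esscher Γ P θ a b = (P.tilted W).tilted fun ω => -θ * X ω := by
    rw [tilted_tilted hWint, esscher]
    congr 1 with ω
    simp only [Pi.add_apply, W, X]
    ring
  refine ⟨hX.aemeasurable, ?_⟩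
  rw [hsplit, map_tilted_comp hX (measurable_const_mul (-θ)),
    map_tilted_of_indepFun hX hW hXW hWint, (hΓ.increment_law u v huv).map_eq]
  exact tilted_gammaMeasure (sub_pos.2 huv) one_pos (by positivity)

lemma lintegral_sub_esscher (hΓ : IsGammaProcess Γ P) (hθ : 0 ≤ θ) (hau : a ≤ u) (huv : u < v)
    (hvb : v ≤ b) :
    ∫⁻ ω, ENNReal.ofReal (Γ v ω - Γ u ω) ∂esscher Γ P θ a b =
      ENNReal.ofReal (((v : ℝ) - u) / (1 + θ)) := by
  have huv' : (0 : ℝ) < v - u := sub_pos.2 huv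
  rw [← lintegral_ofReal_gammaMeasure huv' (by positivity)]
  exact (hΓ.hasLaw_sub_esscher hθ hau huv hvb).lintegral_comp (by fun_prop)

end IsGammaProcess

end Esscher

section Bind

variable {α E F : Type*} [MeasurableSpace α] [MeasurableSpace E] [NormedAddCommGroup F]
  {m : Measure α} {μ : α → Measure E} {f : E → F}

lemma ae_integrable_of_integrable_bind (hμ : AEMeasurable μ m)
    (hf : Integrable f (m.bind μ)) : ∀ᵐ x ∂m, Integrable f (μ x) := by
  obtain ⟨g, hg, hfg⟩ := hf.1
  have hlint := hf.2
  rw [HasFiniteIntegral, Measure.lintegral_bind hμ hf.1.enorm] at hlint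
  have hlint_meas : AEMeasurable (fun x => ∫⁻ y, ‖f y‖ₑ ∂μ x) m :=
    (Measure.aemeasurable_lintegral hf.1.enorm).comp_aemeasurable hμ
  filter_upwards [Measure.ae_ae_of_ae_bind hμ hfg, ae_lt_top' hlint_meas hlint.ne]
    with x hx hx'
  exact ⟨⟨g, hg, hx⟩, hx'⟩

lemma measure_le_norm_integral_le_lintegral_bind_div [NormedSpace ℝ F] (hμ : AEMeasurable μ m)
    (hf : AEStronglyMeasurable f (m.bind μ)) {c : ℝ} (hc : 0 < c) :
    m {x | c ≤ ‖∫ y, f y ∂μ x‖} ≤ (∫⁻ y, ‖f y‖ₑ ∂m.bind μ) / ENNReal.ofReal c :=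
  calc m {x | c ≤ ‖∫ y, f y ∂μ x‖} ≤ m {x | ENNReal.ofReal c ≤ ∫⁻ y, ‖f y‖ₑ ∂μ x} := by
        refine measure_mono fun x hx => (ENNReal.ofReal_le_ofReal hx).trans ?_
        rw [ofReal_norm]
        exact enorm_integral_le_lintegral_enorm _
    _ ≤ (∫⁻ x, ∫⁻ y, ‖f y‖ₑ ∂μ x ∂m) / ENNReal.ofReal c :=
        meas_ge_le_lintegral_div ((Measure.aemeasurable_lintegral hf.enorm).comp_aemeasurable hμ)
          (ENNReal.ofReal_pos.2 hc).ne' ENNReal.ofReal_ne_top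
    _ = (∫⁻ y, ‖f y‖ₑ ∂m.bind μ) / ENNReal.ofReal c := by
        rw [Measure.lintegral_bind hμ hf.enorm]

end Bind

section RandomMeasure

lemma pathMeasure_Ioc {γ : ℝ≥0 → ℝ} (h : Monotone γ ∧ ∀ t, ContinuousWithinAt γ (Ici t) t)
    (x y : ℝ) : pathMeasure γ (Ioc x y) = ENNReal.ofReal (γ y.toNNReal - γ x.toNNReal) := by
  rw [pathMeasure, dif_pos h, StieltjesFunction.measure_Ioc]
  rfl

instance (γ : ℝ≥0 → ℝ) : IsLocallyFiniteMeasure (pathMeasure γ) := by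
  unfold pathMeasure
  split_ifs <;> infer_instance

variable {Ω : Type*} [MeasurableSpace Ω] {P : Measure Ω} {Γ : ℝ≥0 → Ω → ℝ} {θ : ℝ}
  {a b : ℝ≥0}

/-- The random measure `dΓ` on the interval `(a, b]`. -/
noncomputable def incrementMeasure (Γ : ℝ≥0 → Ω → ℝ) (a b : ℝ≥0) (ω : Ω) : Measure ℝ :=
  (pathMeasure fun s => Γ s ω).restrict (Ioc a b)

instance (ω : Ω) : IsFiniteMeasure (incrementMeasure Γ a b ω) := by
  unfold incrementMeasure
  exact isFiniteMeasure_restrict.2 measure_Ioc_lt_top.ne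

namespace IsGammaProcess

lemma aemeasurable_incrementMeasure (hΓ : IsGammaProcess Γ P) (a b : ℝ≥0) :
    AEMeasurable (incrementMeasure Γ a b) P := by
  obtain ⟨G, hGP, hG, hpaths⟩ := hΓ.paths.exists_measurable_mem
  rw [← Measure.restrict_eq_self_of_ae_mem hGP]
  refine aemeasurable_restrict_of_measurable_subtype hG ?_
  have hIoc (x y : ℝ) : Measurable fun ω : G => incrementMeasure Γ a b ω (Ioc x y) := by
    simp only [incrementMeasure, Measure.restrict_apply measurableSet_Ioc, Ioc_inter_Ioc]
    simp_rw [fun ω : G => pathMeasure_Ioc (hpaths ω ω.2)]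
    exact (((hΓ.measurable _).sub (hΓ.measurable _)).comp measurable_subtype_coe).ennreal_ofReal
  refine .measure_of_isPiSystem ((BorelSpace.measurable_eq (α := ℝ)).trans
    (borel_eq_generateFrom_Ioc ℝ)) (isPiSystem_Ioc id id) ?_ ?_
  · rintro s ⟨x, y, -, rfl⟩
    exact hIoc x y
  · simpa only [incrementMeasure, Measure.restrict_apply_univ,
      Measure.restrict_apply measurableSet_Ioc, inter_self] using hIoc a b

variable [IsProbabilityMeasure P]

lemma esscher_bind_incrementMeasure (hΓ : IsGammaProcess Γ P) (hθ : 0 ≤ θ) :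
    (esscher Γ P θ a b).bind (incrementMeasure Γ a b) =
      ENNReal.ofReal (1 + θ)⁻¹ • volume.restrict (Ioc (a : ℝ) b) := by
  have := (volume.restrict (Ioc (a : ℝ) b)).smul_finite (ENNReal.ofReal_ne_top (r := (1 + θ)⁻¹))
  refine (Measure.ext_of_Ioc _ _ fun x y _ => ?_).symm
  rw [Measure.bind_apply measurableSet_Ioc
    ((hΓ.aemeasurable_incrementMeasure a b).mono_ac esscher_absolutelyContinuous)]
  simp only [incrementMeasure, Measure.smul_apply, Measure.restrict_apply measurableSet_Ioc,
    Ioc_inter_Ioc]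
  rcases le_or_gt (y ⊓ b) (x ⊔ a) with hempty | hlt
  · simp [Ioc_eq_empty_of_le hempty]
  have hau : (a : ℝ) ≤ x ⊔ a := le_sup_right
  have hvb : y ⊓ b ≤ b := inf_le_right
  lift x ⊔ a to ℝ≥0 using a.2.trans hau with u
  lift y ⊓ b to ℝ≥0 using u.2.trans hlt.le with v
  calc ENNReal.ofReal (1 + θ)⁻¹ • volume (Ioc (u : ℝ) v)
      = ENNReal.ofReal (((v : ℝ) - u) / (1 + θ)) := by
        rw [Real.volume_Ioc, smul_eq_mul, ← ENNReal.ofReal_mul (by positivity), div_eq_inv_mul]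
    _ = ∫⁻ ω, ENNReal.ofReal (Γ v ω - Γ u ω) ∂esscher Γ P θ a b :=
        (hΓ.lintegral_sub_esscher hθ hau hlt hvb).symm
    _ = ∫⁻ ω, pathMeasure (fun s => Γ s ω) (Ioc u v) ∂esscher Γ P θ a b := by
        refine lintegral_congr_ae (esscher_absolutelyContinuous.ae_le ?_)
        filter_upwards [hΓ.paths] with ω hω
        rw [pathMeasure_Ioc hω, Real.toNNReal_coe, Real.toNNReal_coe]

lemma ae_integrable_incrementMeasure (hΓ : IsGammaProcess Γ P) {f : ℝ → ℝ}
    (hf : IntegrableOn f (Ioc a b)) : ∀ᵐ ω ∂P, Integrable f (incrementMeasure Γ a b ω) := by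
  refine ae_integrable_of_integrable_bind (hΓ.aemeasurable_incrementMeasure a b) ?_
  have hmean := hΓ.esscher_bind_incrementMeasure (a := a) (b := b) le_rfl
  rw [esscher_zero, add_zero, inv_one, ENNReal.ofReal_one, one_smul] at hmean
  rwa [hmean]

lemma measureReal_esscher_le_abs_integral_le (hΓ : IsGammaProcess Γ P) (hθ : 0 ≤ θ) {f : ℝ → ℝ}
    (hf : IntegrableOn f (Ioc a b)) {c : ℝ} (hc : 0 < c) :
    (esscher Γ P θ a b).real {ω | c ≤ |∫ x, f x ∂incrementMeasure Γ a b ω|} ≤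
      (∫ x in Ioc (a : ℝ) b, |f x|) / ((1 + θ) * c) := by
  have hmean := hΓ.esscher_bind_incrementMeasure (a := a) (b := b) hθ
  have hmarkov := measure_le_norm_integral_le_lintegral_bind_div
    ((hΓ.aemeasurable_incrementMeasure a b).mono_ac (esscher_absolutelyContinuous (θ := θ)))
    (by rw [hmean]; exact hf.1.smul_measure _) hc
  rw [hmean, lintegral_smul_measure, smul_eq_mul, ← ofReal_integral_norm_eq_lintegral_enorm hf,
    ← ENNReal.ofReal_mul (by positivity), ← ENNReal.ofReal_div_of_pos hc] at hmarkov
  refine (ENNReal.toReal_le_of_le_ofReal (by positivity) hmarkov).trans_eq ?_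
  simp only [Real.norm_eq_abs]
  field_simp

lemma one_sub_le_measureReal_abs_integral_lt (hΓ : IsGammaProcess Γ P) (hθ : 0 ≤ θ) (hab : a < b)
    {f : ℝ → ℝ} (hf : IntegrableOn f (Ioc a b)) {c : ℝ} (hc : 0 < c) :
    1 - (∫ x in Ioc (a : ℝ) b, |f x|) / ((1 + θ) * c) ≤
      (1 + θ) ^ ((b : ℝ) - a) * P.real {ω | |∫ x, f x ∂incrementMeasure Γ a b ω| < c} := by
  have := hΓ.isProbabilityMeasure_esscher hθ hab.le
  set A := {ω | |∫ x, f x ∂incrementMeasure Γ a b ω| < c} with hA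
  have hAc : Aᶜ = {ω | c ≤ |∫ x, f x ∂incrementMeasure Γ a b ω|} := by
    ext ω
    simp [hA]
  have hcover : 1 ≤ (esscher Γ P θ a b).real A + (esscher Γ P θ a b).real Aᶜ := by
    rw [← probReal_univ (μ := esscher Γ P θ a b), ← union_compl_self A]
    exact measureReal_union_le _ _
  have hmarkov := hΓ.measureReal_esscher_le_abs_integral_le hθ hf hc
  have hdens := hΓ.measureReal_esscher_le hθ hab A
  rw [hAc] at hcover
  linarith

end IsGammaProcess

end RandomMeasure

section OrderlyDivergence

variable {Ω : Type*} [MeasurableSpace Ω] {P : Measure Ω} [IsProbabilityMeasure P]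
  {Γ : ℝ≥0 → Ω → ℝ} {f : ℝ → ℝ}

lemma IsGammaProcess.ae_gammaIntegral_sub (hΓ : IsGammaProcess Γ P) {s t : ℝ≥0} (hst : s ≤ t)
    (hf : IntegrableOn f (Ioc 0 t)) :
    ∀ᵐ ω ∂P, gammaIntegral Γ f t ω - gammaIntegral Γ f s ω =
      ∫ x, f x ∂incrementMeasure Γ s t ω := by
  filter_upwards [hΓ.ae_integrable_incrementMeasure (a := 0) hf] with ω hω
  have hint : IntegrableOn f (Ioc 0 t) (pathMeasure fun r => Γ r ω) := hω
  have hsplit := setIntegral_union (μ := pathMeasure fun r => Γ r ω) (f := f)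
    (Ioc_disjoint_Ioc_of_le (a := 0) (d := (t : ℝ)) (le_refl (s : ℝ))) measurableSet_Ioc
    (hint.mono_set (Ioc_subset_Ioc_right hst)) (hint.mono_set (Ioc_subset_Ioc_left s.coe_nonneg))
  rw [Ioc_union_Ioc_eq_Ioc s.coe_nonneg (NNReal.coe_le_coe.2 hst)] at hsplit
  exact sub_eq_of_eq_add' hsplit

lemma sub_sub_lt_sub_of_abs_div_sub_one_lt {x y l m η : ℝ} (hl : 0 < l) (hlm : l ≤ m)
    (hx : |x / l - 1| < η) (hy : |y / m - 1| < η) : m - l - 2 * η * m < y - x := by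
  have hη : 0 < η := (abs_nonneg _).trans_lt hx
  have hx' : x < (η + 1) * l := by
    rw [← div_lt_iff₀ hl]
    linarith [(abs_lt.1 hx).2]
  have hy' : (1 - η) * m < y := by
    rw [← lt_div_iff₀ (hl.trans_le hlm)]
    linarith [(abs_lt.1 hy).1]
  have hηlm : η * l ≤ η * m := by gcongr
  linarith

lemma IsGammaProcess.one_sixth_le_measureReal (hΓ : IsGammaProcess Γ P)
    (hf0 : ∀ x, 0 < x → 0 ≤ f x) {s t : ℝ≥0} (hts : t = s + 1) (hf : IntegrableOn f (Ioc 0 t))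
    (hlt : lam f s < lam f t) :
    1 / 6 ≤ P.real {ω | |∫ x, f x ∂incrementMeasure Γ s t ω| < 3 / 4 * (lam f t - lam f s)} := by
  have hst : s < t := hts ▸ lt_add_one s
  have hgap : (t : ℝ) - s = 1 := by simp [hts]
  have hmass : ∫ x in Ioc (s : ℝ) t, |f x| = lam f t - lam f s := by
    rw [lam_sub_lam hf s.coe_nonneg (NNReal.coe_le_coe.2 hst.le)]
    exact setIntegral_congr_fun measurableSet_Ioc fun x hx =>
      abs_of_nonneg (hf0 x (s.coe_nonneg.trans_lt hx.1))
  have hd : 0 < lam f t - lam f s := sub_pos.2 hlt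
  have h := hΓ.one_sub_le_measureReal_abs_integral_lt zero_le_one hst
    (hf.mono_set (Ioc_subset_Ioc_left s.coe_nonneg)) (mul_pos (by norm_num : (0 : ℝ) < 3 / 4) hd)
  have hratio : (lam f t - lam f s) / ((1 + 1) * (3 / 4 * (lam f t - lam f s))) = 2 / 3 := by
    field_simp
    norm_num
  rw [hmass, hratio, hgap, Real.rpow_one] at h
  linarith

lemma IsGammaProcess.one_sub_lt_lam_div_lam (hΓ : IsGammaProcess Γ P)
    (hf0 : ∀ x, 0 < x → 0 ≤ f x) {s t : ℝ≥0} (hts : t = s + 1) (hf : IntegrableOn f (Ioc 0 t))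
    (hpos : 0 < lam f s) {ε : ℝ} (hε : 0 < ε)
    (hs : P.real {ω | ε / 8 ≤ |gammaIntegral Γ f s ω / lam f s - 1|} < 1 / 12)
    (ht : P.real {ω | ε / 8 ≤ |gammaIntegral Γ f t ω / lam f t - 1|} < 1 / 12) :
    1 - ε < lam f s / lam f t := by
  by_contra! hle
  have hst : s ≤ t := hts ▸ le_self_add
  have hmono : lam f s ≤ lam f t := lam_le_lam hf0 hf hst
  have hpos' : 0 < lam f t := hpos.trans_le hmono
  have hgap : ε * lam f t ≤ lam f t - lam f s := by
    rw [div_le_iff₀ hpos'] at hle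
    linarith
  have hlt : lam f s < lam f t := sub_pos.1 ((mul_pos hε hpos').trans_le hgap)
  have hincl : {ω | |∫ x, f x ∂incrementMeasure Γ s t ω| < 3 / 4 * (lam f t - lam f s)} ≤ᵐ[P]
      ({ω | ε / 8 ≤ |gammaIntegral Γ f s ω / lam f s - 1|} ∪
        {ω | ε / 8 ≤ |gammaIntegral Γ f t ω / lam f t - 1|} : Set Ω) := by
    filter_upwards [hΓ.ae_gammaIntegral_sub hst hf] with ω hω (hsmall : |_| < _)
    by_contra hclose
    obtain ⟨hs, ht⟩ := not_or.1 hclose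
    have := sub_sub_lt_sub_of_abs_div_sub_one_lt hpos hmono (not_le.1 hs) (not_le.1 ht)
    have := (le_abs_self _).trans_lt hsmall
    linarith
  have hlower := hΓ.one_sixth_le_measureReal hf0 hts hf hlt
  have hupper := (ENNReal.toReal_mono (measure_ne_top P _) (measure_mono_ae hincl)).trans
    (measureReal_union_le _ _)
  exact (hlower.trans hupper).not_gt (by linarith)

lemma IsGammaProcess.tendsto_lRatio (hΓ : IsGammaProcess Γ P) (hf0 : ∀ x, 0 < x → 0 ≤ f x)
    (hf : ∀ t, 0 < t → IntegrableOn f (Ioc 0 t)) (hOD : OrderlyDivergent Γ P f) :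
    Tendsto (lRatio f) atTop (𝓝 1) := by
  have hshift : Tendsto (fun t : ℝ => t - 1) atTop atTop :=
    tendsto_atTop_add_const_right atTop (-1) tendsto_id
  refine tendsto_order.2 ⟨fun c hc => ?_, fun c hc => ?_⟩
  · have hprob := (tendstoInMeasure_iff_measureReal_norm.1 hOD.2 ((1 - c) / 8)
      (by linarith)).eventually_lt_const (by norm_num : (0 : ℝ) < 1 / 12)
    filter_upwards [hprob, hshift.eventually hprob, eventually_ge_atTop 1,
      hshift.eventually (hOD.1.eventually_gt_atTop 0)] with t ht hs h1t hpos
    obtain ⟨s, rfl⟩ : ∃ s : ℝ≥0, t = s + 1 :=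
      ⟨(t - 1).toNNReal, by rw [Real.coe_toNNReal _ (sub_nonneg.2 h1t), sub_add_cancel]⟩
    have h := hΓ.one_sub_lt_lam_div_lam hf0 (s := s) (t := s + 1) rfl
      (hf _ (by positivity)) (by simpa using hpos) (sub_pos.2 hc) (by simpa using hs)
      (by simpa using ht)
    simpa [lRatio] using h
  · filter_upwards [eventually_gt_atTop 0] with t ht
    exact (lRatio_le_one hf0 (hf t ht)).trans_lt hc

end OrderlyDivergence

end GammaOD

theorem mainTheorem4_general (f : ℝ → ℝ) (hf_nonneg : ∀ x, 0 < x → 0 ≤ f x)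
    (hf_loc : ∀ t, 0 < t → IntegrableOn f (Ioc 0 t) volume) :
    (∀ (Ω : Type*) [MeasurableSpace Ω] (P : Measure Ω) [IsProbabilityMeasure P]
        (Γ : ℝ≥0 → Ω → ℝ), GammaOD.IsGammaProcess Γ P →
        GammaOD.OrderlyDivergent Γ P f → Tendsto (GammaOD.lRatio f) atTop (𝓝 1)) ∧
    ((∀ t, 0 < t → MemLp f 2 (volume.restrict (Ioc 0 t))) → Tendsto (GammaOD.lam f) atTop atTop →
        Tendsto (GammaOD.bRatio f) atTop (𝓝 0) → Tendsto (GammaOD.vRatio f) atTop (𝓝 0)) ∧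
    (∀ T, MonotoneOn f (Ioi T) ∨ AntitoneOn f (Ioi T) → (∃ t, 0 < GammaOD.lam f t) →
        (Tendsto (GammaOD.lRatio f) atTop (𝓝 1) ↔ Tendsto (GammaOD.bRatio f) atTop (𝓝 0))) := by
  refine ⟨fun Ω _ P _ Γ hΓ hOD => hΓ.tendsto_lRatio hf_nonneg hf_loc hOD,
    fun hf2 hlam hb => GammaOD.tendsto_vRatio hf_nonneg hf_loc
      (fun t ht => (hf2 t ht).integrable_sq) hlam hb, ?_⟩
  rintro T (hmono | hanti) hpos
  · exact ⟨GammaOD.tendsto_bRatio_of_monotoneOn hf_nonneg hf_loc hmono hpos,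
      GammaOD.tendsto_lRatio_of_monotoneOn hf_nonneg hf_loc hmono hpos⟩
  · exact iff_of_true (GammaOD.tendsto_lRatio_of_antitoneOn hf_nonneg hf_loc hanti hpos)
      (GammaOD.tendsto_bRatio_of_antitoneOn hf_nonneg hf_loc hanti hpos)

theorem mainTheorem4 (f : ℝ → ℝ) (hf_nonneg : ∀ x, 0 < x → 0 ≤ f x)
    (hf_loc : ∀ t, 0 < t → IntegrableOn f (Ioc 0 t) volume) :
    (∀ (Ω : Type*) [MeasurableSpace Ω] (P : Measure Ω) [IsProbabilityMeasure P]
        (Γ : ℝ≥0 → Ω → ℝ), GammaOD.IsGammaProcess Γ P →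
        GammaOD.OrderlyDivergent Γ P f → Tendsto (GammaOD.lRatio f) atTop (𝓝 1)) ∧
    ((∀ t, 0 < t → MemLp f 2 (volume.restrict (Ioc 0 t))) → Tendsto f atTop atTop →
        Tendsto (GammaOD.bRatio f) atTop (𝓝 0) → Tendsto (GammaOD.vRatio f) atTop (𝓝 0)) ∧
    ((MonotoneOn f (Ioi 0) ∨ AntitoneOn f (Ioi 0)) → (∃ t, 0 < GammaOD.lam f t) →
        (Tendsto (GammaOD.lRatio f) atTop (𝓝 1) ↔ Tendsto (GammaOD.bRatio f) atTop (𝓝 0))) := by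
  obtain ⟨hOD, hv, hmono⟩ := mainTheorem4_general f hf_nonneg hf_loc
  exact ⟨hOD, fun hf2 hf_top => hv hf2 (GammaOD.tendsto_lam_atTop hf_nonneg hf_loc hf_top),
    hmono 0⟩
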